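/- Let $n>3$ and let $V_0,V_1,\dots,V_{2n-1}$ be pairwise distinct points on a circle (the set of points at a fixed geodesic distance $r>0$ from a centre) in the Euclidean plane, in the hyperbolic plane of curvature $-1$, or on the unit sphere, labelled in the cyclic order in which they occur along the circle (in one of its two directions). Put $V_{2n}=V_0$, and let $l_{ij}$ be the length of the geodesic segment $V_iV_j$, that is, the geodesic distance between $V_i$ and $V_j$. Let $s(x)=\frac x2$ in Euclidean geometry, $s(x)=\sinh\frac x2$ in hyperbolic geometry, and $s(x)=\sin\frac x2$ in spherical geometry. Then $s(l_{ij})\neq 0$ for all $0\le i,j\le 2n-1$ with $i\neq j$, so that the numbers $$a_{ji}=(-1)^{\delta_{ij}}\bigl(s(l_{2i-2,\,2j-1})\,s(l_{2j-1,\,2i})\bigr)^{-1}\qquad(1\le i,j\le n)$$ are well defined, where $\delta_{ij}$ is the Kronecker delta, and the $n\times n$ matrix $(a_{ij})_{1\le i,j\le n}$ satisfies $$\det(a_{ij})=0.$$ -/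

import Mathlib

/-- The three classical plane geometries. -/
inductive ClassicalGeometry where
  | euclidean
  | hyperbolic
  | spherical

namespace ClassicalGeometry

/-- The points: the Euclidean plane, the hyperbolic plane (upper half-plane model),
the unit sphere in Euclidean three-space. -/
def Point : ClassicalGeometry → Type
  | euclidean => EuclideanSpace ℝ (Fin 2)
  | hyperbolic => UpperHalfPlane
  | spherical => Metric.sphere (0 : EuclideanSpace ℝ (Fin 3)) 1

/-- The usual topology on each of the three surfaces. -/
instance instTopologicalSpacePoint : (g : ClassicalGeometry) → TopologicalSpace g.Point
  | euclidean => inferInstanceAs (TopologicalSpace (EuclideanSpace ℝ (Fin 2)))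
  | hyperbolic => inferInstanceAs (TopologicalSpace UpperHalfPlane)
  | spherical =>
      inferInstanceAs (TopologicalSpace (Metric.sphere (0 : EuclideanSpace ℝ (Fin 3)) 1))

/-- The geodesic distance, i.e. the length of a (shortest) geodesic segment joining two points:
the Euclidean distance, the hyperbolic distance of curvature `-1`, and on the unit sphere
the angle (in `[0, π]`) between the two unit vectors. -/
noncomputable def geodesicDist : (g : ClassicalGeometry) → g.Point → g.Point → ℝ
  | euclidean => fun (P Q : EuclideanSpace ℝ (Fin 2)) => dist P Q
  | hyperbolic => fun (P Q : UpperHalfPlane) => dist P Q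
  | spherical => fun (P Q : Metric.sphere (0 : EuclideanSpace ℝ (Fin 3)) 1) =>
      InnerProductGeometry.angle (P : EuclideanSpace ℝ (Fin 3)) (Q : EuclideanSpace ℝ (Fin 3))

/-- The function `s`: `x / 2`, `sinh (x / 2)` or `sin (x / 2)`. -/
noncomputable def s : ClassicalGeometry → ℝ → ℝ
  | euclidean => fun x => x / 2
  | hyperbolic => fun x => Real.sinh (x / 2)
  | spherical => fun x => Real.sin (x / 2)

/-- The circle with centre `c` and radius `r`. -/
def circle (g : ClassicalGeometry) (c : g.Point) (r : ℝ) : Set g.Point :=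
  {P | g.geodesicDist c P = r}

end ClassicalGeometry

/-- `V 0, …, V (m - 1)` are pairwise distinct points of the simple closed curve `C`, met in this
order when `C` is traversed once in one of its two directions. The traversal is a continuous
`1`-periodic map `γ` that is injective on one period and has image `C`. -/
def InCyclicOrderOn {X : Type*} [TopologicalSpace X] {m : ℕ} (C : Set X) (V : Fin m → X) : Prop :=
  ∃ γ : ℝ → X, Continuous γ ∧ Function.Periodic γ 1 ∧ Set.InjOn γ (Set.Ico 0 1) ∧
    Set.range γ = C ∧
    ∃ t : Fin m → ℝ, StrictMono t ∧ (∀ k, t k ∈ Set.Ico (0 : ℝ) 1) ∧ ∀ k, γ (t k) = V k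

/-- The `n × n` matrix whose entry in row `j` and column `i` is, for `1 ≤ i, j ≤ n`,
`(-1) ^ δ i j * (s (l (2 i - 2) (2 j - 1)) * s (l (2 j - 1) (2 i)))⁻¹`, where `l a b` is the
geodesic distance of `V a` and `V b`, and `V (2 n)` means `V 0`. In the code `i` and `j` start
at `0`, so that the three indices are `2 i`, `2 j + 1` and `2 i + 2` (modulo `2 n`). -/
noncomputable def gregoracMatrix (g : ClassicalGeometry) (n : ℕ) (V : Fin (2 * n) → g.Point) :
    Matrix (Fin n) (Fin n) ℝ :=
  Matrix.of fun j i =>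
    (-1 : ℝ) ^ (if i = j then 1 else 0) *
      (g.s (g.geodesicDist (V ⟨2 * i.val, by have := i.isLt; omega⟩)
          (V ⟨2 * j.val + 1, by have := j.isLt; omega⟩)) *
        g.s (g.geodesicDist (V ⟨2 * j.val + 1, by have := j.isLt; omega⟩)
          (V ⟨(2 * i.val + 2) % (2 * n), Nat.mod_lt _ (by have := i.isLt; omega)⟩)))⁻¹

/-! In all three geometries `s` of a chord of a fixed circle is a constant times the absolute sine
of the difference of half central angles. Write `x i` for the half angles of the even vertices, `y
j` for those of the odd ones, and `x n = x 0 + π` for the return to the start. Then sin(x (i+1) - x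
i) / (sin(y j - x i) sin(y j - x (i+1))) = cot(y j - x (i+1)) - cot(y j - x i). The denominator is
negative exactly when `y j` lies between `x i` and `x (i+1)`, that is for `i = j`, so the factor
`(-1) ^ δ` undoes the absolute values. Each row paired with the vector sin(x (i+1) - x i) therefore
telescopes, to zero because cot has period `π`. This nonzero kernel vector makes the determinant
vanish. `exists_strictMonoOn_norm_sub_eq` supplies the angles, and `hasCircularChart` reduces each
geometry to the unit circle. -/

/-! ### A kernel vector by telescoping cotangents -/

theorem det_inv_sin_mul_sin_eq_zero {n : ℕ} (hn : 2 ≤ n) {ρ : ℝ} (x y : ℕ → ℝ)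
    (hx : x n = x 0 + Real.pi)
    (hxy : ∀ i j, i ≤ j → j < n → x i < y j ∧ y j < x i + Real.pi)
    (hyx : ∀ i j, j < i → i ≤ n → y j < x i ∧ x i < y j + Real.pi) :
    (Matrix.of fun j i : Fin n => (-1 : ℝ) ^ (if i = j then 1 else 0) *
      (ρ * |Real.sin (x i - y j)| * (ρ * |Real.sin (y j - x (i + 1))|))⁻¹).det = 0 := by
  have hpos : ∀ i j, i ≤ j → j < n → 0 < Real.sin (y j - x i) := fun i j h h' =>
    Real.sin_pos_of_pos_of_lt_pi (by linarith [(hxy i j h h').1]) (by linarith [(hxy i j h h').2])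
  have hneg : ∀ i j, j < i → i ≤ n → Real.sin (y j - x i) < 0 := fun i j h h' =>
    Real.sin_neg_of_neg_of_neg_pi_lt (by linarith [(hyx i j h h').1])
      (by linarith [(hyx i j h h').2])
  rw [← Matrix.exists_mulVec_eq_zero_iff]
  refine ⟨fun i => Real.sin (x (i + 1) - x i), fun h => ?_, ?_⟩
  -- Since `2 ≤ n`, `x 0 < y 0 < x 1 < y 1 < x 0 + π`, so entry 0 is positive; for `n = 1` it would
  -- be sin π = 0.
  · have h0 := congrFun h ⟨0, by omega⟩
    simp only [zero_add, Pi.zero_apply] at h0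
    refine absurd h0 (Real.sin_pos_of_pos_of_lt_pi ?_ ?_).ne'
    · linarith [(hxy 0 0 le_rfl (by omega)).1, (hyx 1 0 (by omega) (by omega)).1]
    · linarith [(hxy 1 1 le_rfl (by omega)).1, (hxy 0 1 (by omega) (by omega)).2]
  · ext j
    set F : ℕ → ℝ := fun i => Real.cos (y j - x i) / Real.sin (y j - x i) with hF
    have key : ∀ i : Fin n, (-1 : ℝ) ^ (if i = j then 1 else 0) *
        (ρ * |Real.sin (x i - y j)| * (ρ * |Real.sin (y j - x (i + 1))|))⁻¹ *
          Real.sin (x (i + 1) - x i) = (ρ * ρ)⁻¹ * (F (i + 1) - F i) := by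
      intro i
      have hs : |Real.sin (x i - y j)| = |Real.sin (y j - x i)| := by
        rw [← neg_sub, Real.sin_neg, abs_neg]
      have hsin : Real.sin (x (i + 1) - x i) =
          Real.sin (y j - x i) * Real.cos (y j - x (i + 1)) -
            Real.cos (y j - x i) * Real.sin (y j - x (i + 1)) := by
        rw [← Real.sin_sub]; ring_nf
      rw [hs, hsin]
      have hne : ∀ k, k ≤ n → Real.sin (y j - x k) ≠ 0 := fun k hk =>
        (le_or_gt k j).elim (fun h => (hpos k j h j.2).ne') fun h => (hneg k j h hk).ne
      have h1 := hne i i.2.le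
      have h2 := hne (i + 1) i.2
      -- For `ρ = 0` both sides vanish, as `0⁻¹ = 0`.
      by_cases hρ : ρ = 0
      · simp [hρ]
      rcases lt_trichotomy (i : ℕ) j with h | h | h
      · rw [if_neg (by simp [Fin.ext_iff, h.ne]), abs_of_pos (hpos _ _ h.le j.2),
          abs_of_pos (hpos _ _ h j.2)]
        simp only [hF]; field_simp
      · rw [if_pos (Fin.ext h), abs_of_pos (hpos _ _ h.le j.2),
          abs_of_neg (hneg _ _ (by omega) i.2)]
        simp only [hF]; field_simp
      · rw [if_neg (by simp [Fin.ext_iff, h.ne']), abs_of_neg (hneg _ _ h i.2.le),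
          abs_of_neg (hneg _ _ (by omega) i.2)]
        simp only [hF]; field_simp
    simp only [Matrix.mulVec, dotProduct, Matrix.of_apply, key, ← Finset.mul_sum,
      Pi.zero_apply]
    rw [Fin.sum_univ_eq_sum_range (fun i => F (i + 1) - F i), Finset.sum_range_sub]
    simp only [hF, hx, ← sub_sub, Real.sin_sub_pi, Real.cos_sub_pi, neg_div_neg_eq, sub_self,
      mul_zero]

/-! ### Angles along a curve in the unit circle -/

theorem norm_circleExp_sub (a b : ℝ) :
    ‖(Circle.exp a : ℂ) - Circle.exp b‖ = 2 * |Real.sin ((a - b) / 2)| := by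
  have h : (Circle.exp a : ℂ) - Circle.exp b =
      Circle.exp b * (Complex.exp (Complex.I * (a - b : ℝ)) - 1) := by
    simp only [Circle.coe_exp, mul_sub, mul_one, ← Complex.exp_add]
    push_cast; ring_nf
  rw [h, norm_mul, Circle.norm_coe, one_mul, Complex.norm_exp_I_mul_ofReal_sub_one, norm_mul,
    Real.norm_eq_abs, Real.norm_eq_abs, abs_of_pos (two_pos : (0 : ℝ) < 2)]

/-- Lift `u` through the covering `Circle.exp`. The lift is continuous and injective on the
interval, hence strictly monotone there; a decreasing lift is negated, which keeps chord lengths.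
Were its spread `2π` or more, the intermediate value theorem would give a second parameter with the
same value of `u`. -/
theorem exists_strictMonoOn_norm_sub_eq (u : ℝ → Circle) (hu : Continuous u)
    (hinj : Set.InjOn u (Set.Ico 0 1)) :
    ∃ f : ℝ → ℝ, StrictMonoOn f (Set.Ico 0 1) ∧
      (∀ a ∈ Set.Ico (0 : ℝ) 1, ∀ b ∈ Set.Ico (0 : ℝ) 1, f b < f a + 2 * Real.pi) ∧
      ∀ a b, ‖(u a : ℂ) - u b‖ = 2 * |Real.sin ((f a - f b) / 2)| := by
  obtain ⟨e, he⟩ : ∃ e, Circle.exp e = u 0 := ⟨_, Circle.exp_arg (u 0)⟩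
  obtain ⟨f, ⟨-, hf⟩, -⟩ :=
    Circle.isCoveringMap_exp.existsUnique_continuousMap_lifts ⟨u, hu⟩ 0 e he
  have hfu : ∀ a, u a = Circle.exp (f a) := fun a => (congrFun hf a).symm
  have hfinj : Set.InjOn f (Set.Ico 0 1) := fun a ha b hb h =>
    hinj ha hb (by rw [hfu, hfu, h])
  have hspread : ∀ a ∈ Set.Ico (0 : ℝ) 1, ∀ b ∈ Set.Ico (0 : ℝ) 1,
      f b < f a + 2 * Real.pi := by
    intro a ha b hb
    by_contra! h
    have hmem : f a + 2 * Real.pi ∈ Set.uIcc (f a) (f b) :=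
      Set.mem_uIcc_of_le (by linarith [Real.pi_pos]) h
    obtain ⟨d, hd, hd'⟩ := intermediate_value_uIcc f.continuous.continuousOn hmem
    have hdI : d ∈ Set.Ico (0 : ℝ) 1 := Set.ordConnected_Ico.uIcc_subset ha hb hd
    have : d = a := hinj hdI ha (by
      rw [hfu, hfu, hd', Circle.exp_add, Circle.exp_two_pi, mul_one])
    rw [this] at hd'
    linarith [Real.pi_pos]
  have hnorm : ∀ a b, ‖(u a : ℂ) - u b‖ = 2 * |Real.sin ((f a - f b) / 2)| := fun a b => by
    rw [hfu, hfu, norm_circleExp_sub]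
  have : Set.OrdConnected (Set.Ico (0 : ℝ) 1) := Set.ordConnected_Ico
  have hmono : StrictMonoOn f (Set.Ico 0 1) ∨ StrictAntiOn f (Set.Ico 0 1) := by
    let _ : Inhabited (Set.Ico (0 : ℝ) 1) := ⟨⟨0, by simp⟩⟩
    exact (Continuous.strictMono_of_inj (f := Set.domRestrict (Set.Ico 0 1) f)
      (f.continuous.comp continuous_subtype_val) hfinj.injective).imp
        strictMono_domRestrict.mp Set.strictAntiOn_iff_strictAnti.mpr
  rcases hmono with hm | hm
  · exact ⟨f, hm, hspread, hnorm⟩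
  · refine ⟨fun a => -f a, hm.neg, fun a ha b hb => ?_, fun a b => ?_⟩
    · linarith [hspread b hb a ha]
    · rw [hnorm, ← abs_neg, ← Real.sin_neg]
      congr 3; ring

/-! ### Charts of geodesic circles in the three geometries -/

namespace ClassicalGeometry

theorem eq_of_s_geodesicDist_eq_zero (g : ClassicalGeometry) {P Q : g.Point}
    (h : g.s (g.geodesicDist P Q) = 0) : P = Q := by
  cases g with
  | euclidean =>
    let p : EuclideanSpace ℝ (Fin 2) := P
    let q : EuclideanSpace ℝ (Fin 2) := Q
    have h' : dist p q / 2 = 0 := h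
    have hpq : p = q := dist_eq_zero.mp (by linarith)
    exact hpq
  | hyperbolic =>
    let p : UpperHalfPlane := P
    let q : UpperHalfPlane := Q
    have h' : dist p q / 2 = 0 := Real.sinh_eq_zero.mp h
    have hpq : p = q := dist_eq_zero.mp (by linarith)
    exact hpq
  | spherical =>
    let p : Metric.sphere (0 : EuclideanSpace ℝ (Fin 3)) 1 := P
    let q : Metric.sphere (0 : EuclideanSpace ℝ (Fin 3)) 1 := Q
    have h' : Real.sin (InnerProductGeometry.angle (p : EuclideanSpace ℝ (Fin 3)) q / 2) = 0 := h
    have h0 := InnerProductGeometry.angle_nonneg (p : EuclideanSpace ℝ (Fin 3)) q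
    have h1 := InnerProductGeometry.angle_le_pi (p : EuclideanSpace ℝ (Fin 3)) q
    have h2 : InnerProductGeometry.angle (p : EuclideanSpace ℝ (Fin 3)) q = 0 := by
      by_contra hne
      have := lt_of_le_of_ne h0 (Ne.symm hne)
      exact (Real.sin_pos_of_pos_of_lt_pi (by linarith) (by linarith [Real.pi_pos])).ne' h'
    have hi : inner ℝ (p : EuclideanSpace ℝ (Fin 3)) q = 1 := by
      rw [← InnerProductGeometry.cos_eq_one_iff_angle_eq_zero, InnerProductGeometry.cos_angle,
        norm_eq_of_mem_sphere, norm_eq_of_mem_sphere] at h2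
      linarith
    have hpq : p = q := Subtype.ext ((inner_eq_one_iff_of_norm_eq_one (𝕜 := ℝ)
      (norm_eq_of_mem_sphere p) (norm_eq_of_mem_sphere q)).mp hi)
    exact hpq

/-- A continuous map to `ℂ` that takes the circle of centre `c` and radius `r` to the unit circle
and takes `s` of the geodesic distance to a constant multiple of the distance. -/
def HasCircularChart (g : ClassicalGeometry) (c : g.Point) (r : ℝ) : Prop :=
  ∃ (Φ : g.Point → ℂ) (ρ : ℝ), Continuous Φ ∧ (∀ P ∈ g.circle c r, ‖Φ P‖ = 1) ∧
    ∀ P ∈ g.circle c r, ∀ Q ∈ g.circle c r,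
      g.s (g.geodesicDist P Q) = ρ * ‖Φ P - Φ Q‖

theorem hasCircularChart_euclidean (c : euclidean.Point) {r : ℝ} (hr : 0 < r) :
    HasCircularChart euclidean c r := by
  let L : EuclideanSpace ℝ (Fin 2) ≃ₗᵢ[ℝ] ℂ := Complex.orthonormalBasisOneI.repr.symm
  let c' : EuclideanSpace ℝ (Fin 2) := c
  have hnr : ‖(r : ℂ)‖ = r := by simp [hr.le]
  suffices h : ∃ (Φ : EuclideanSpace ℝ (Fin 2) → ℂ) (ρ : ℝ), Continuous Φ ∧
      (∀ P, dist c' P = r → ‖Φ P‖ = 1) ∧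
      ∀ P, dist c' P = r → ∀ Q, dist c' Q = r → dist P Q / 2 = ρ * ‖Φ P - Φ Q‖ from h
  refine ⟨fun P => L (P - c') / r, r / 2, ?_, fun P hP => ?_, fun P _ Q _ => ?_⟩
  · exact (L.continuous.comp (continuous_id.sub continuous_const)).div_const _
  · rw [norm_div, L.norm_map, hnr, ← dist_eq_norm, dist_comm, hP, div_self hr.ne']
  · rw [← sub_div, ← map_sub, norm_div, L.norm_map, hnr, sub_sub_sub_cancel_right, dist_eq_norm]
    field_simp

/-- The Cayley transform sending the centre to 0 maps the circle to the Euclidean circle of radius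
tanh(r/2), which is then rescaled. On the circle `|P - conj c|` depends on `P` only through `√P.im`,
which cancels the denominator in the formula for sinh(d/2). -/
theorem hasCircularChart_hyperbolic (c : hyperbolic.Point) {r : ℝ} (hr : 0 < r) :
    HasCircularChart hyperbolic c r := by
  let c' : UpperHalfPlane := c
  suffices h : ∃ (Φ : UpperHalfPlane → ℂ) (ρ : ℝ), Continuous Φ ∧
      (∀ P, dist c' P = r → ‖Φ P‖ = 1) ∧
      ∀ P, dist c' P = r → ∀ Q, dist c' Q = r →
        Real.sinh (dist P Q / 2) = ρ * ‖Φ P - Φ Q‖ from h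
  have hne : ∀ P : UpperHalfPlane, (P : ℂ) - starRingEnd ℂ (c' : ℂ) ≠ 0 := fun P h => by
    have := congrArg Complex.im h
    simp at this
    linarith [P.im_pos, c'.im_pos]
  have ht : 0 < Real.tanh (r / 2) := by
    rw [Real.tanh_eq_sinh_div_cosh]
    exact div_pos (Real.sinh_pos_iff.mpr (by linarith)) (Real.cosh_pos _)
  have hnt : ‖(Real.tanh (r / 2) : ℂ)‖ = Real.tanh (r / 2) := by
    rw [Complex.norm_real, Real.norm_eq_abs, abs_of_pos ht]
  have hconj : ∀ P, dist c' P = r → ‖(P : ℂ) - starRingEnd ℂ (c' : ℂ)‖ =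
      2 * Real.cosh (r / 2) * √P.im * √c'.im := fun P hP => by
    have h := UpperHalfPlane.cosh_half_dist P c'
    have := P.im_pos
    have := c'.im_pos
    rw [dist_comm, hP, Real.sqrt_mul P.im_pos.le, eq_div_iff (by positivity), dist_eq_norm] at h
    rw [← h]; ring
  refine ⟨fun P => ((P : ℂ) - c') / ((P : ℂ) - starRingEnd ℂ (c' : ℂ)) / (Real.tanh (r / 2) : ℝ),
    Real.tanh (r / 2) * Real.cosh (r / 2) ^ 2, ?_, fun P hP => ?_, fun P hP Q hQ => ?_⟩
  · exact ((UpperHalfPlane.continuous_coe.sub continuous_const).div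
      (UpperHalfPlane.continuous_coe.sub continuous_const) hne).div_const _
  · rw [norm_div, norm_div, hnt, ← dist_eq_norm, ← dist_eq_norm, ← UpperHalfPlane.tanh_half_dist,
      dist_comm, hP, div_self ht.ne']
  · have hsub : ((P : ℂ) - c') / ((P : ℂ) - starRingEnd ℂ (c' : ℂ)) -
        ((Q : ℂ) - c') / ((Q : ℂ) - starRingEnd ℂ (c' : ℂ)) =
        ((P : ℂ) - Q) * ((c' : ℂ) - starRingEnd ℂ (c' : ℂ)) /
          (((P : ℂ) - starRingEnd ℂ (c' : ℂ)) * ((Q : ℂ) - starRingEnd ℂ (c' : ℂ))) := by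
      have := hne P
      have := hne Q
      field_simp
      ring
    have him : ‖(c' : ℂ) - starRingEnd ℂ (c' : ℂ)‖ = 2 * √c'.im ^ 2 := by
      rw [Real.sq_sqrt c'.im_pos.le, Complex.sub_conj, norm_mul, Complex.norm_I, mul_one,
        Complex.norm_real, Real.norm_eq_abs, UpperHalfPlane.coe_im,
        abs_of_pos (mul_pos two_pos c'.im_pos)]
    have hc := Real.cosh_pos (r / 2)
    have h1 := Real.sqrt_pos.mpr P.im_pos
    have h2 := Real.sqrt_pos.mpr Q.im_pos
    have h3 := Real.sqrt_pos.mpr c'.im_pos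
    rw [← sub_div, hsub, norm_div, norm_div, norm_mul, norm_mul, hnt, hconj P hP, hconj Q hQ, him,
      UpperHalfPlane.sinh_half_dist, Real.sqrt_mul P.im_pos.le, dist_eq_norm]
    field_simp

theorem norm_sub_eq_two_mul_sin_angle_div_two {E : Type*} [NormedAddCommGroup E]
    [InnerProductSpace ℝ E] {x y : E} (hx : ‖x‖ = 1) (hy : ‖y‖ = 1) :
    ‖x - y‖ = 2 * Real.sin (InnerProductGeometry.angle x y / 2) := by
  have h := InnerProductGeometry.norm_sub_sq_eq_norm_sq_add_norm_sq_sub_two_mul_norm_mul_norm_mul_cos_angle x y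
  have h0 := InnerProductGeometry.angle_nonneg x y
  have h1 := InnerProductGeometry.angle_le_pi x y
  have hs : 0 ≤ Real.sin (InnerProductGeometry.angle x y / 2) :=
    Real.sin_nonneg_of_nonneg_of_le_pi (by linarith) (by linarith)
  rw [← sq_eq_sq₀ (norm_nonneg _) (by positivity), mul_pow, Real.sin_sq_eq_half_sub,
    mul_div_cancel₀ _ (two_ne_zero' ℝ), sq, h, hx, hy]
  ring

/-- The circle lies in a plane orthogonal to the axis `v`, so projection onto `vᗮ` preserves its
chords and gives a circle of radius sin r. Nontriviality excludes `r = π`, where only the antipode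
remains. -/
theorem hasCircularChart_spherical (c : spherical.Point) {r : ℝ} (hr : 0 < r)
    (hC : (spherical.circle c r).Nontrivial) : HasCircularChart spherical c r := by
  let c' : Metric.sphere (0 : EuclideanSpace ℝ (Fin 3)) 1 := c
  let v : EuclideanSpace ℝ (Fin 3) := c'
  have hv : ‖v‖ = 1 := by simp [v]
  have hC' : {P : Metric.sphere (0 : EuclideanSpace ℝ (Fin 3)) 1 |
      InnerProductGeometry.angle v P = r}.Nontrivial := hC
  have hrpi : r < Real.pi := by
    obtain ⟨P, hP, Q, hQ, hPQ⟩ := hC'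
    refine lt_of_le_of_ne (hP ▸ InnerProductGeometry.angle_le_pi _ _) fun h => hPQ ?_
    have key : ∀ R : Metric.sphere (0 : EuclideanSpace ℝ (Fin 3)) 1,
        InnerProductGeometry.angle v R = r → v = -R := fun R hR => by
      rw [h, ← InnerProductGeometry.cos_eq_neg_one_iff_angle_eq_pi,
        InnerProductGeometry.cos_angle, hv] at hR
      refine (inner_eq_one_iff_of_norm_eq_one (𝕜 := ℝ) hv (by simp)).mp ?_
      rw [inner_neg_right]
      simp at hR
      linarith
    exact Subtype.ext (neg_injective ((key P hP).symm.trans (key Q hQ)))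
  have hsin : 0 < Real.sin r := Real.sin_pos_of_pos_of_lt_pi hr hrpi
  have hns : ‖(Real.sin r : ℂ)‖ = Real.sin r := by
    rw [Complex.norm_real, Real.norm_eq_abs, abs_of_pos hsin]
  have : Fact (Module.finrank ℝ (EuclideanSpace ℝ (Fin 3)) = 2 + 1) := ⟨by simp⟩
  let L : (ℝ ∙ v)ᗮ ≃ₗᵢ[ℝ] ℂ :=
    (OrthonormalBasis.fromOrthogonalSpanSingleton 2
      (norm_ne_zero_iff.mp (hv ▸ one_ne_zero))).repr.trans Complex.orthonormalBasisOneI.repr.symm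
  let π := (ℝ ∙ v)ᗮ.orthogonalProjectionOnto
  have hinner : ∀ P : Metric.sphere (0 : EuclideanSpace ℝ (Fin 3)) 1,
      InnerProductGeometry.angle v P = r → inner ℝ v P = Real.cos r := fun P hP => by
    rw [← hP, InnerProductGeometry.cos_angle, hv]; simp
  suffices h : ∃ (Φ : Metric.sphere (0 : EuclideanSpace ℝ (Fin 3)) 1 → ℂ) (ρ : ℝ), Continuous Φ ∧
      (∀ P : Metric.sphere (0 : EuclideanSpace ℝ (Fin 3)) 1, InnerProductGeometry.angle v P = r → ‖Φ P‖ = 1) ∧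
      ∀ P : Metric.sphere (0 : EuclideanSpace ℝ (Fin 3)) 1, InnerProductGeometry.angle v P = r →
      ∀ Q : Metric.sphere (0 : EuclideanSpace ℝ (Fin 3)) 1, InnerProductGeometry.angle v Q = r →
        Real.sin (InnerProductGeometry.angle (P : EuclideanSpace ℝ (Fin 3)) Q / 2) =
          ρ * ‖Φ P - Φ Q‖ from h
  refine ⟨fun P => L (π P) / (Real.sin r : ℝ), Real.sin r / 2, ?_, fun P hP => ?_,
    fun P hP Q hQ => ?_⟩
  · exact (L.continuous.comp (π.continuous.comp continuous_subtype_val)).div_const _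
  · have h := Submodule.norm_sq_eq_add_norm_sq_projection (P : EuclideanSpace ℝ (Fin 3)) (ℝ ∙ v)
    have hproj : ‖(ℝ ∙ v).orthogonalProjectionOnto (P : EuclideanSpace ℝ (Fin 3))‖ ^ 2 =
        Real.cos r ^ 2 := by
      rw [← Submodule.norm_coe, Submodule.coe_orthogonalProjectionOnto_apply,
        Submodule.starProjection_unit_singleton ℝ hv, hinner P hP, norm_smul, hv, mul_one,
        Real.norm_eq_abs, sq_abs]
    have hπ : ‖π P‖ = Real.sin r := by
      rw [← sq_eq_sq₀ (norm_nonneg _) hsin.le, Real.sin_sq, ← hproj]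
      have : ‖(P : EuclideanSpace ℝ (Fin 3))‖ = 1 := by simp
      rw [this] at h
      simp only [π]
      linarith
    rw [norm_div, L.norm_map, hns, hπ, div_self hsin.ne']
  · have hmem : (P : EuclideanSpace ℝ (Fin 3)) - Q ∈ (ℝ ∙ v)ᗮ := by
      rw [Submodule.mem_orthogonal_singleton_iff_inner_right, inner_sub_right, hinner P hP,
        hinner Q hQ, sub_self]
    have hπ : ‖π ((P : EuclideanSpace ℝ (Fin 3)) - Q)‖ = ‖(P : EuclideanSpace ℝ (Fin 3)) - Q‖ :=
      Submodule.norm_orthogonalProjectionOnto_apply _ hmem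
    rw [← sub_div, ← map_sub, ← map_sub, norm_div, L.norm_map, hns, hπ,
      norm_sub_eq_two_mul_sin_angle_div_two (by simp) (by simp)]
    field_simp

theorem hasCircularChart (g : ClassicalGeometry) (c : g.Point) {r : ℝ} (hr : 0 < r)
    (hC : (g.circle c r).Nontrivial) : g.HasCircularChart c r := by
  cases g with
  | euclidean => exact hasCircularChart_euclidean c hr
  | hyperbolic => exact hasCircularChart_hyperbolic c hr
  | spherical => exact hasCircularChart_spherical c hr hC

end ClassicalGeometry

/-! ### Half angles of the vertices and the determinant -/

/-- Points in cyclic order on a circle have increasing half central angles, spread over less than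
`π`, in terms of which `s` of the distances is a multiple of the absolute value of a sine. -/
theorem InCyclicOrderOn.exists_half_angles {g : ClassicalGeometry} {m : ℕ} {c : g.Point} {r : ℝ}
    (hr : 0 < r) {V : Fin m → g.Point} (hV : InCyclicOrderOn (g.circle c r) V) :
    ∃ (φ : Fin m → ℝ) (ρ : ℝ), StrictMono φ ∧ (∀ i j, φ j < φ i + Real.pi) ∧
      ∀ i j, g.s (g.geodesicDist (V i) (V j)) = ρ * |Real.sin (φ i - φ j)| := by
  obtain ⟨γ, hγ, -, hinj, hrange, t, ht, htI, htV⟩ := hV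
  have hmem : ∀ a, γ a ∈ g.circle c r := fun a => hrange ▸ Set.mem_range_self a
  have hC : (g.circle c r).Nontrivial := ⟨γ 0, hmem 0, γ (1 / 2), hmem _, fun h => by
    have := hinj (by norm_num) (by norm_num) h
    norm_num at this⟩
  obtain ⟨Φ, ρ, hΦ, hnorm, hdist⟩ := g.hasCircularChart c hr hC
  let u : ℝ → Circle := fun a => ⟨Φ (γ a), mem_sphere_zero_iff_norm.mpr (hnorm _ (hmem a))⟩
  have hu : Continuous u := (hΦ.comp hγ).subtype_mk _
  have huinj : Set.InjOn u (Set.Ico 0 1) := fun a ha b hb h => by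
    have h' : Φ (γ a) = Φ (γ b) := congrArg Subtype.val h
    refine hinj ha hb (g.eq_of_s_geodesicDist_eq_zero ?_)
    rw [hdist _ (hmem a) _ (hmem b), h', sub_self, norm_zero, mul_zero]
  obtain ⟨f, hf, hspread, hfu⟩ := exists_strictMonoOn_norm_sub_eq u hu huinj
  refine ⟨fun k => f (t k) / 2, ρ * 2, fun i j hij => ?_, fun i j => ?_, fun i j => ?_⟩
  · have := hf (htI i) (htI j) (ht hij)
    simp only
    linarith
  · have := hspread _ (htI i) _ (htI j)
    simp only
    linarith
  · rw [← htV, ← htV, hdist _ (hmem _) _ (hmem _), mul_assoc, ← sub_div, ← hfu]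

theorem mainTheorem2 (g : ClassicalGeometry) (n : ℕ) (hn : 3 < n) (c : g.Point) (r : ℝ)
    (hr : 0 < r) (V : Fin (2 * n) → g.Point) (hV : InCyclicOrderOn (g.circle c r) V) :
    (∀ i j : Fin (2 * n), i ≠ j → g.s (g.geodesicDist (V i) (V j)) ≠ 0) ∧
      (gregoracMatrix g n V).det = 0 := by
  refine ⟨fun i j hij h => ?_, ?_⟩
  · have hVij := g.eq_of_s_geodesicDist_eq_zero h
    obtain ⟨γ, -, -, hinj, -, t, ht, htI, htV⟩ := hV
    rw [← htV, ← htV] at hVij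
    exact hij (ht.injective (hinj (htI i) (htI j) hVij))
  · obtain ⟨φ, ρ, hφ, hspread, hdist⟩ := hV.exists_half_angles hr
    -- The index `n` stands for the vertex `V 0` reached after a full turn, so its half angle is
    -- shifted by `π`. The value 0 of `y` beyond `n` is never used.
    let x : ℕ → ℝ := fun i => if h : i < n then φ ⟨2 * i, by omega⟩
      else φ ⟨0, by omega⟩ + Real.pi
    let y : ℕ → ℝ := fun j => if h : j < n then φ ⟨2 * j + 1, by omega⟩ else 0
    have hxlt : ∀ i (h : i < n), x i = φ ⟨2 * i, by omega⟩ := fun i h => dif_pos h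
    have hxn : x n = φ ⟨0, by omega⟩ + Real.pi := dif_neg (lt_irrefl n)
    have hy : ∀ j (h : j < n), y j = φ ⟨2 * j + 1, by omega⟩ := fun j h => dif_pos h
    have hdet := det_inv_sin_mul_sin_eq_zero (n := n) (by omega) (ρ := ρ) x y
      (by rw [hxn, hxlt 0 (by omega)])
      (fun i j hij hj => by
        rw [hxlt i (by omega), hy j hj]
        exact ⟨hφ (Fin.mk_lt_mk.mpr (by omega)), hspread _ _⟩)
      (fun i j hij hi => by
        rw [hy j (by omega)]
        rcases hi.lt_or_eq with h | rfl
        · rw [hxlt i h]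
          exact ⟨hφ (Fin.mk_lt_mk.mpr (by omega)), hspread _ _⟩
        · rw [hxn]
          exact ⟨hspread _ _, add_lt_add_left (hφ (Fin.mk_lt_mk.mpr (by omega))) _⟩)
    rw [← hdet]
    congr 1
    ext j i
    have hlast : |Real.sin (φ ⟨2 * j.val + 1, by omega⟩ -
        φ ⟨(2 * i.val + 2) % (2 * n), Nat.mod_lt _ (by omega)⟩)| =
        |Real.sin (y j - x (i + 1))| := by
      rw [hy j j.2]
      -- Only in the last column does the index wrap around to 0; the shift by `π` then just changes
      -- the sign of the sine.
      rcases (Nat.succ_le_of_lt i.2).lt_or_eq with h | h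
      · rw [hxlt _ h]
        congr 5
        rw [Nat.mod_eq_of_lt (by omega)]
        rfl
      · have h0 : (2 * i.val + 2) % (2 * n) = 0 := by
          rw [show 2 * i.val + 2 = 2 * n by omega, Nat.mod_self]
        rw [show i.val + 1 = n from h, hxn, ← sub_sub, Real.sin_sub_pi, abs_neg]
        simp only [h0]
    simp only [gregoracMatrix, Matrix.of_apply, hdist, hlast, hxlt i i.2, hy j j.2]
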